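/- **Proposition (weak Jost–Schroer theorem in curved spacetime).** Let $M=(\mathcal M,g)$ be a globally hyperbolic spacetime: $\mathcal M$ is a smooth connected (Hausdorff, second countable) manifold of dimension $D\ge 2$ with a smooth time-oriented Lorentzian metric $g$ of signature $(+,-,\dots,-)$. Let $\mathcal U_M=\bigoplus_{n\ge 0}C_0^\infty(M^{\times n})$ (finite direct sums, $C_0^\infty(M^{\times 0})=\mathbb C$) be the Borchers–Uhlmann algebra, whose product is the tensor product of test functions and whose involution is $f^*(x_n,\dots,x_1)=\overline{f(x_1,\dots,x_n)}$. A *state* $\omega$ is a normalised, positive, continuous linear functional on $\mathcal U_M$, i.e. a sequence of distributions $\omega_n$ on $M^{\times n}$ with $\omega_0=1$ and $\omega(A^*A)\ge 0$ for all $A\in\mathcal U_M$. Put $\omega_{2-}(x_2,x_1)=\tfrac12\bigl(\omega_2(x_2,x_1)-\omega_2(x_1,x_2)\bigr)$. For a bi-distribution $E$ on $M^{\times 2}$, the state $\omega$ is a *generalised free field state with commutator $E$* if it vanishes on the two-sided $*$-ideal of $\mathcal U_M$ generated by the elements $f\otimes h-h\otimes f-iE(f,h)I$ with $f,h\in C_0^\infty(M)$;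 it is a *generalised free field state* if this holds for some $E$. For $m,\xi\in\mathbb R$ let $K=\Box+m^2+\xi R$ be the Klein–Gordon operator ($R$ is the scalar curvature). The state $\omega$ *satisfies the Klein–Gordon equation* with parameters $m,\xi$ if it vanishes on the two-sided $*$-ideal generated by the elements $Kf$, $f\in C_0^\infty(M)$. Let $E_{m,\xi}$ be the difference of the advanced and the retarded fundamental solution of $K$, regarded as a bi-distribution. The state $\omega$ is a *free field state* with parameters $m,\xi$ if it satisfies the Klein–Gordon equation with these parameters and is a generalised free field state with commutator $E_{m,\xi}$. Let $\omega$ be a generalised free field state on $\mathcal U_M$ and suppose that, for some $m,\xi\in\mathbb R$, its two-point distribution satisfies the Klein–Gordon equation in both arguments, i.e. $\omega_2(Kf,h)=0=\omega_2(h,Kf)$ for all $f,h\in C_0^\infty(M)$, and $\omega_{2-}=\tfrac i2E_{m,\xi}$. Then $\omega$ is a free field state with parameters $m,\xi$. In particular $\omega_{a+1+b}(A\otimes Kf\otimes B)=0$ for all $a,b\ge0$, $A\in C_0^\infty(M^{\times a})$, $f\in C_0^\infty(M)$, $B\in C_0^\infty(M^{\times b})$. -/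

import Mathlib

open scoped Manifold ContDiff DirectSum

noncomputable section

namespace CurvedQFT

/-! ## Spacetimes -/

/-- The model space `ℝ^D`. -/
abbrev Coord (D : ℕ) : Type := EuclideanSpace ℝ (Fin D)

/-- The `i`-th coordinate vector of `ℝ^D`. -/
def stdVec {D : ℕ} (i : Fin D) : Coord D := EuclideanSpace.single i 1

/-- The partial derivative `∂_i F`. -/
def pderiv {D : ℕ} {V : Type*} [NormedAddCommGroup V] [NormedSpace ℝ V]
    (i : Fin D) (F : Coord D → V) (y : Coord D) : V :=
  fderiv ℝ F y (stdVec i)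

section Geometry

variable (D : ℕ) (M : Type*) [TopologicalSpace M] [ChartedSpace (Coord D) M]
  [IsManifold 𝓘(ℝ, Coord D) ∞ M]

/-- A smooth Lorentzian metric of signature `(+,-,…,-)`, together with a time orientation.
The signature is expressed by saying that at each point some vector `v` has `g(v,v) > 0` and `g` is
negative definite on the `g`-orthogonal complement of `v`. The time orientation is given
by a continuous timelike vector field. -/
structure Spacetime where
  /-- the metric -/
  metric (x : M) :
    TangentSpace 𝓘(ℝ, Coord D) x →L[ℝ] TangentSpace 𝓘(ℝ, Coord D) x →L[ℝ] ℝ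
  symm (x : M) (v w : TangentSpace 𝓘(ℝ, Coord D) x) : metric x v w = metric x w v
  lorentzian (x : M) : ∃ v : TangentSpace 𝓘(ℝ, Coord D) x, 0 < metric x v v ∧
    ∀ w : TangentSpace 𝓘(ℝ, Coord D) x, metric x v w = 0 → w ≠ 0 → metric x w w < 0
  smooth : ContMDiff 𝓘(ℝ, Coord D)
    (𝓘(ℝ, Coord D).prod 𝓘(ℝ, Coord D →L[ℝ] Coord D →L[ℝ] ℝ)) ∞
    (fun x ↦ Bundle.TotalSpace.mk' (Coord D →L[ℝ] Coord D →L[ℝ] ℝ)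
      (E := fun x : M ↦ TangentSpace 𝓘(ℝ, Coord D) x →L[ℝ]
        TangentSpace 𝓘(ℝ, Coord D) x →L[ℝ] ℝ) x (metric x))
  /-- a vector field that is declared to be future pointing -/
  timeField (x : M) : TangentSpace 𝓘(ℝ, Coord D) x
  timeField_continuous : Continuous
    (fun x ↦ (⟨x, timeField x⟩ : TangentBundle 𝓘(ℝ, Coord D) M))
  timeField_timelike (x : M) : 0 < metric x (timeField x) (timeField x)

namespace Spacetime

variable {D M} (S : Spacetime D M)

/-! ### Causal structure -/

/-- Future pointing causal (non-zero) tangent vectors. -/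
def IsFutureCausal (x : M) (v : TangentSpace 𝓘(ℝ, Coord D) x) : Prop :=
  0 ≤ S.metric x v v ∧ 0 < S.metric x v (S.timeField x)

/-- `p` and `q` are joined by a smooth future directed causal curve, with parameter interval
`[0,1]`. -/
def CausalStep (p q : M) : Prop :=
  ∃ γ : ℝ → M, ContMDiff 𝓘(ℝ, ℝ) 𝓘(ℝ, Coord D) ∞ γ ∧ γ 0 = p ∧ γ 1 = q ∧
    ∀ t ∈ Set.Icc (0 : ℝ) 1,
      S.IsFutureCausal (γ t) (mfderiv 𝓘(ℝ, ℝ) 𝓘(ℝ, Coord D) γ t (1 : ℝ))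

/-- `q ∈ J⁺(p)`: either `q = p` or there is a piecewise smooth future directed causal curve
from `p` to `q`. -/
def CausallyPrecedes (p q : M) : Prop := Relation.ReflTransGen S.CausalStep p q

/-- The causal future `J⁺(A)`. -/
def causalFuture (A : Set M) : Set M := {q | ∃ p ∈ A, S.CausallyPrecedes p q}

/-- The causal past `J⁻(A)`. -/
def causalPast (A : Set M) : Set M := {p | ∃ q ∈ A, S.CausallyPrecedes p q}

/-- Global hyperbolicity: there are no closed causal curves and all the sets `J⁺(p) ∩ J⁻(q)` are
compact. -/
def IsGloballyHyperbolic : Prop :=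
  (∀ p : M, ¬ Relation.TransGen S.CausalStep p p) ∧
    ∀ p q : M, IsCompact (S.causalFuture {p} ∩ S.causalPast {q})

/-! ### Curvature and the Klein-Gordon operator in coordinates -/

/-- The coordinate vector `∂_i` of the chart `e` at the point with coordinates `y`. -/
def coordVec (e : OpenPartialHomeomorph M (Coord D)) (y : Coord D) (i : Fin D) :
    TangentSpace 𝓘(ℝ, Coord D) (e.symm y) :=
  letI : ChartedSpace (Coord D) (Coord D) := chartedSpaceSelf _
  mfderiv 𝓘(ℝ, Coord D) 𝓘(ℝ, Coord D) e.symm y (stdVec i)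

/-- The matrix `g_{ij}` of the metric in the chart `e`, at the coordinate value `y`. -/
def gram (e : OpenPartialHomeomorph M (Coord D)) (y : Coord D) :
    Matrix (Fin D) (Fin D) ℝ :=
  Matrix.of fun i j ↦ S.metric (e.symm y) (coordVec e y i) (coordVec e y j)

/-- The inverse matrix `g^{ij}`. -/
def gramInv (e : OpenPartialHomeomorph M (Coord D)) (y : Coord D) :
    Matrix (Fin D) (Fin D) ℝ := (S.gram e y)⁻¹

/-- The Christoffel symbol `Γ^k_{ij} = ½ g^{kl} (∂_i g_{jl} + ∂_j g_{il} - ∂_l g_{ij})`. -/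
def christoffel (e : OpenPartialHomeomorph M (Coord D)) (k i j : Fin D) (y : Coord D) : ℝ :=
  (1 / 2) * ∑ l, S.gramInv e y k l *
    (pderiv i (fun z ↦ S.gram e z j l) y + pderiv j (fun z ↦ S.gram e z i l) y
      - pderiv l (fun z ↦ S.gram e z i j) y)

/-- The Ricci tensor
`R_{ij} = ∂_k Γ^k_{ij} - ∂_j Γ^k_{ik} + Γ^k_{kl} Γ^l_{ij} - Γ^k_{jl} Γ^l_{ik}`. -/
def ricci (e : OpenPartialHomeomorph M (Coord D)) (i j : Fin D) (y : Coord D) : ℝ :=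
  ∑ k, (pderiv k (S.christoffel e k i j) y - pderiv j (S.christoffel e k i k) y
    + ∑ l, (S.christoffel e k k l y * S.christoffel e l i j y
      - S.christoffel e k j l y * S.christoffel e l i k y))

/-- The scalar curvature `R = g^{ij} R_{ij}`, computed in the preferred chart at `x`. -/
def scalarCurvature (x : M) : ℝ :=
  let e := chartAt (Coord D) x
  ∑ i, ∑ j, S.gramInv e (e x) i j * S.ricci e i j (e x)

/-- The d'Alembertian `□f = g^{ij} (∂_i ∂_j f - Γ^k_{ij} ∂_k f)`, computed in the preferred chart
at `x`. -/
def dAlembertian (f : M → ℂ) (x : M) : ℂ :=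
  let e := chartAt (Coord D) x
  let F : Coord D → ℂ := fun y ↦ f (e.symm y)
  ∑ i, ∑ j, (S.gramInv e (e x) i j : ℂ) *
    (pderiv i (pderiv j F) (e x) - ∑ k, (S.christoffel e k i j (e x) : ℂ) * pderiv k F (e x))

/-- The Klein-Gordon operator `K = □ + m² + ξR`. -/
def kleinGordon (m ξ : ℝ) (f : M → ℂ) (x : M) : ℂ :=
  S.dAlembertian f x + ((m ^ 2 + ξ * S.scalarCurvature x : ℝ) : ℂ) * f x

/-- The metric volume measure: on the domain of a chart it is `√|det g_{ij}| dy`. As these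
expressions agree on overlaps of charts, the measure is the supremum of the measures so obtained
from the charts of the atlas. -/
def volumeMeasure [MeasurableSpace M] : MeasureTheory.Measure M :=
  ⨆ e ∈ atlas (Coord D) M,
    ((MeasureTheory.volume.restrict e.target).withDensity
      (fun y ↦ ENNReal.ofReal (Real.sqrt |(S.gram e y).det|))).map e.symm

end Spacetime

end Geometry

/-! ## Test functions and distributions -/

section TestFunctions

variable {F H : Type*} [NormedAddCommGroup F] [NormedSpace ℝ F] [TopologicalSpace H]
  (J : ModelWithCorners ℝ F H) (N : Type*) [TopologicalSpace N] [ChartedSpace H N]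

/-- The space `C₀^∞(N)` of smooth compactly supported complex functions on the manifold `N`. -/
def testFunctions : Submodule ℂ (N → ℂ) where
  carrier := {f | ContMDiff J 𝓘(ℝ, ℂ) ∞ f ∧ HasCompactSupport f}
  add_mem' hf hg := ⟨hf.1.add hg.1, hf.2.add hg.2⟩
  zero_mem' := ⟨contMDiff_const, HasCompactSupport.zero⟩
  smul_mem' c f hf := by
    refine ⟨?_, hf.2.smul_left (f := fun _ ↦ c)⟩
    exact ((contDiff_const_smul (𝕜 := ℝ) c).contMDiff).comp hf.1

variable {J N}

/-- A linear functional on `C₀^∞(N)` is a distribution (is continuous in the test function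
topology) iff on the functions supported in any given compact set it is bounded by finitely many
of the seminorms `sup_{y ∈ L} ‖D^k (f ∘ φ⁻¹)(y)‖`, where `φ` is a chart of `N` (the preferred chart
at a point), `L` a compact subset of the range of `φ` and `k ∈ ℕ`. -/
def IsDistribution (T : testFunctions J N →ₗ[ℂ] ℂ) : Prop :=
  ∀ K : Set N, IsCompact K → ∃ (s : Finset (N × Set F × ℕ)) (C : ℝ),
    (∀ i ∈ s, IsCompact i.2.1 ∧ i.2.1 ⊆ (extChartAt J i.1).target) ∧
    ∀ f : testFunctions J N, tsupport (f : N → ℂ) ⊆ K → ∀ B : ℝ, 0 ≤ B →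
      (∀ i ∈ s, ∀ y ∈ i.2.1,
        ‖iteratedFDeriv ℝ i.2.2 (fun z ↦ (f : N → ℂ) ((extChartAt J i.1).symm z)) y‖ ≤ B) →
      ‖T f‖ ≤ C * B

end TestFunctions

section Power

variable (D : ℕ) (M : Type*) [TopologicalSpace M] [ChartedSpace (Coord D) M]

/-- The model of the manifold `M^n`. -/
abbrev powModel (D n : ℕ) :
    ModelWithCorners ℝ (Fin n → Coord D) (ModelPi fun _ : Fin n ↦ Coord D) :=
  ModelWithCorners.pi fun _ ↦ 𝓘(ℝ, Coord D)

/-- The space `C₀^∞(M)`. -/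
abbrev Test : Type _ := testFunctions 𝓘(ℝ, Coord D) M

/-- The space `C₀^∞(M^n)`. The argument with index `0` is the leftmost one. -/
abbrev PowTest (n : ℕ) : Type _ := testFunctions (powModel D n) (Fin n → M)

variable {D M}

/-- Maps `M^b → M^a` that permute, repeat and drop arguments are smooth. -/
theorem contMDiff_reindex {a b : ℕ} (σ : Fin a → Fin b) :
    ContMDiff (powModel D b) (powModel D a) ∞ (fun x : Fin b → M ↦ fun i ↦ x (σ i)) := by
  intro x
  rw [contMDiffAt_iff]
  refine ⟨(by fun_prop : Continuous fun x : Fin b → M ↦ fun i ↦ x (σ i)).continuousAt, ?_⟩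
  have h : ContDiff ℝ ∞ (fun z : Fin b → Coord D ↦ fun i ↦ z (σ i)) := by fun_prop
  refine h.contDiffAt.contDiffWithinAt.congr_of_eventuallyEq ?_ ?_
  · filter_upwards [extChartAt_target_mem_nhdsWithin (I := powModel D b) x] with z hz
    funext i
    have hz' : z (σ i) ∈ (chartAt (Coord D) (x (σ i))).target := by
      have := hz
      simp only [extChartAt, OpenPartialHomeomorph.extend, PartialEquiv.trans_target] at this
      exact this.2 (σ i) (Set.mem_univ _)
    exact (chartAt (Coord D) (x (σ i))).right_inv hz'
  · funext i
    exact (chartAt (Coord D) (x (σ i))).right_inv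
      ((chartAt (Coord D) (x (σ i))).map_source (mem_chart_source _ _))

/-- The coordinate projections `M^b → M` are smooth. -/
theorem contMDiff_proj {b : ℕ} (j : Fin b) :
    ContMDiff (powModel D b) 𝓘(ℝ, Coord D) ∞ (fun x : Fin b → M ↦ x j) := by
  intro x
  rw [contMDiffAt_iff]
  refine ⟨(continuous_apply j).continuousAt, ?_⟩
  have h : ContDiff ℝ ∞ (fun z : Fin b → Coord D ↦ z j) := by fun_prop
  refine h.contDiffAt.contDiffWithinAt.congr_of_eventuallyEq ?_ ?_
  · filter_upwards [extChartAt_target_mem_nhdsWithin (I := powModel D b) x] with z hz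
    have hz' : z j ∈ (chartAt (Coord D) (x j)).target := by
      have := hz
      simp only [extChartAt, OpenPartialHomeomorph.extend, PartialEquiv.trans_target] at this
      exact this.2 j (Set.mem_univ _)
    exact (chartAt (Coord D) (x j)).right_inv hz'
  · exact (chartAt (Coord D) (x j)).right_inv
      ((chartAt (Coord D) (x j)).map_source (mem_chart_source _ _))

/-! ### The operations on test functions that define the Borchers-Uhlmann algebra -/

/-- The function `(f ⊗ g)(x_0,…,x_{a+b-1}) = f(x_0,…,x_{a-1}) g(x_a,…,x_{a+b-1})`. -/
def tensor {a b : ℕ} (f : PowTest D M a) (g : PowTest D M b) : PowTest D M (a + b) :=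
  ⟨fun x ↦ (f : (Fin a → M) → ℂ) (fun i ↦ x (Fin.castAdd b i)) *
      (g : (Fin b → M) → ℂ) (fun i ↦ x (Fin.natAdd a i)), by
    refine ⟨?_, ?_⟩
    · exact contDiff_mul.contMDiff.comp
        ((f.2.1.comp (contMDiff_reindex (Fin.castAdd b))).prodMk_space
          (g.2.1.comp (contMDiff_reindex (Fin.natAdd a))))
    · have hK := (f.2.2.isCompact.prod g.2.2.isCompact).image (Fin.continuous_append (X := M) a b)
      have hc : IsClosed {x : Fin (a + b) → M |
          (fun i ↦ x (Fin.castAdd b i)) ∈ tsupport (f : (Fin a → M) → ℂ) ∧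
          (fun i ↦ x (Fin.natAdd a i)) ∈ tsupport (g : (Fin b → M) → ℂ)} :=
        ((isClosed_tsupport _).preimage (by fun_prop)).inter
          ((isClosed_tsupport _).preimage (by fun_prop))
      refine hK.of_isClosed_subset (isClosed_tsupport _) ((closure_minimal ?_ hc).trans ?_)
      · intro x hx
        rw [Function.mem_support] at hx
        exact ⟨subset_tsupport _ (left_ne_zero_of_mul hx),
          subset_tsupport _ (right_ne_zero_of_mul hx)⟩
      · intro x hx
        exact ⟨(_, _), ⟨hx.1, hx.2⟩, Fin.append_castAdd_natAdd⟩⟩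

/-- The function `1` on the one-point space `M^0`. -/
def unitTest : PowTest D M 0 :=
  ⟨fun _ ↦ 1, contMDiff_const, (Set.toFinite _).isCompact⟩

/-- Reversal of the arguments, `(x_0,…,x_{n-1}) ↦ f(x_{n-1},…,x_0)`. -/
def reverse (n : ℕ) : PowTest D M n →ₗ[ℂ] PowTest D M n where
  toFun f := ⟨fun x ↦ (f : (Fin n → M) → ℂ) (fun i ↦ x i.rev),
    f.2.1.comp (contMDiff_reindex Fin.rev),
    f.2.2.comp_homeomorph
      { toFun := fun (x : Fin n → M) i ↦ x i.rev
        invFun := fun x i ↦ x i.rev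
        left_inv := fun x ↦ by simp
        right_inv := fun x ↦ by simp
        continuous_toFun := by fun_prop
        continuous_invFun := by fun_prop }⟩
  map_add' _ _ := rfl
  map_smul' _ _ := rfl

/-- Complex conjugation of test functions. -/
def conjTest (n : ℕ) : PowTest D M n →+ PowTest D M n where
  toFun f := ⟨fun x ↦ (starRingEnd ℂ) ((f : (Fin n → M) → ℂ) x),
    Complex.conjCLE.contDiff.contMDiff.comp f.2.1,
    f.2.2.comp_left (map_zero _)⟩
  map_zero' := Subtype.ext (funext fun _ ↦ map_zero _)
  map_add' _ _ := Subtype.ext (funext fun _ ↦ map_add _ _ _)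

/-- A function of one point, regarded as an element of `C₀^∞(M^1)`. -/
def oneVar : Test D M →ₗ[ℂ] PowTest D M 1 where
  toFun f := ⟨fun x ↦ (f : M → ℂ) (x 0), f.2.1.comp (contMDiff_proj 0),
    f.2.2.comp_homeomorph (Homeomorph.funUnique (Fin 1) M)⟩
  map_add' _ _ := rfl
  map_smul' _ _ := rfl

/-- The function `(f ⊗ h)(x_2,x_1) = f(x_2) h(x_1)` in `C₀^∞(M^2)`. -/
def tensor₂ (f h : Test D M) : PowTest D M 2 := tensor (oneVar f) (oneVar h)

/-! ### The Borchers-Uhlmann algebra -/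

theorem gradedMk_eq {a b : ℕ} (hab : a = b) (f : PowTest D M a) (g : PowTest D M b)
    (h : ∀ x : Fin b → M, (f : (Fin a → M) → ℂ) (fun i ↦ x (Fin.cast hab i)) =
      (g : (Fin b → M) → ℂ) x) :
    GradedMonoid.mk (A := PowTest D M) a f = GradedMonoid.mk b g := by
  subst hab
  congr 1
  exact Subtype.ext (funext h)

instance gmul : GradedMonoid.GMul (PowTest D M) := ⟨fun f g ↦ tensor f g⟩

instance gone : GradedMonoid.GOne (PowTest D M) := ⟨unitTest⟩

instance gmonoid : GradedMonoid.GMonoid (PowTest D M) where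
  one_mul f := gradedMk_eq (zero_add _) _ _ fun x ↦ by
    refine (one_mul _).trans (congrArg _ (funext fun i ↦ congrArg x (Fin.ext ?_)))
    simp
  mul_one f := gradedMk_eq (add_zero _) _ _ fun x ↦ by
    refine (mul_one _).trans (congrArg _ (funext fun i ↦ congrArg x (Fin.ext ?_)))
    simp
  mul_assoc f g h := gradedMk_eq (add_assoc _ _ _) _ _ fun x ↦ by
    refine (mul_assoc _ _ _).trans (congrArg₂ _ ?_ (congrArg₂ _ ?_ ?_)) <;>
    refine congrArg _ (funext fun i ↦ congrArg x (Fin.ext ?_)) <;> simp [add_assoc]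

instance gring : DirectSum.GRing (PowTest D M) where
  __ := gmonoid
  mul_zero _ := Subtype.ext (funext fun _ ↦ mul_zero _)
  zero_mul _ := Subtype.ext (funext fun _ ↦ zero_mul _)
  mul_add _ _ _ := Subtype.ext (funext fun _ ↦ mul_add _ _ _)
  add_mul _ _ _ := Subtype.ext (funext fun _ ↦ add_mul _ _ _)
  natCast n := (n : ℂ) • unitTest
  natCast_zero := by simp
  natCast_succ n := by
    change ((n + 1 : ℕ) : ℂ) • unitTest = (n : ℂ) • unitTest + unitTest
    rw [Nat.cast_succ, add_smul, one_smul]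
  intCast n := (n : ℂ) • unitTest
  intCast_ofNat n := by simp
  intCast_negSucc_ofNat n := by
    rw [Int.cast_negSucc]
    exact neg_smul ((n + 1 : ℕ) : ℂ) (unitTest : PowTest D M 0)

instance galgebra : DirectSum.GAlgebra ℂ (PowTest D M) where
  toFun := (LinearMap.toSpanSingleton ℂ (PowTest D M 0) unitTest).toAddMonoidHom
  map_one := one_smul ℂ (unitTest : PowTest D M 0)
  map_mul r s := gradedMk_eq (zero_add 0).symm _ _ fun x ↦ by
    change (r * s) * 1 = (r * 1) * (s * 1)
    ring
  commutes r f := gradedMk_eq (add_comm 0 f.1) _ _ fun x ↦ by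
    refine (mul_comm _ _).trans (congrArg₂ _ ?_ rfl)
    refine congrArg _ (funext fun i ↦ congrArg x (Fin.ext ?_))
    exact zero_add _
  smul_def r f := gradedMk_eq (zero_add f.1).symm _ _ fun x ↦ by
    change r * _ = (r * 1) * _
    rw [mul_one]
    refine congrArg (r * ·) (congrArg _ (funext fun i ↦ congrArg x (Fin.ext ?_)))
    exact (zero_add _).symm

variable (D M)

/-- The Borchers-Uhlmann algebra `⊕_n C₀^∞(M^n)`, with the tensor product as multiplication. -/
abbrev BUAlgebra : Type _ := ⨁ n, PowTest D M n

variable {D M}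

instance : Ring (BUAlgebra D M) := DirectSum.ring (PowTest D M)

instance : Algebra ℂ (BUAlgebra D M) := DirectSum.instAlgebra ℂ (PowTest D M)

/-- `f*(x_n,…,x_1)` is the complex conjugate of `f(x_1,…,x_n)`. -/
def buStar : BUAlgebra D M →+ BUAlgebra D M :=
  DirectSum.map fun n ↦ (conjTest n).comp (reverse n).toAddMonoidHom

theorem buStar_of_mul {i j : ℕ} (f : PowTest D M i) (g : PowTest D M j) :
    buStar (DirectSum.of (PowTest D M) i f * DirectSum.of (PowTest D M) j g) =
      buStar (DirectSum.of (PowTest D M) j g) * buStar (DirectSum.of (PowTest D M) i f) := by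
  simp only [buStar, DirectSum.of_mul_of, DirectSum.map_of]
  refine DirectSum.of_eq_of_gradedMonoid_eq (gradedMk_eq (add_comm i j) _ _ fun x ↦ ?_)
  refine (map_mul (starRingEnd ℂ) _ _).trans ((mul_comm _ _).trans (congrArg₂ _ ?_ ?_)) <;>
  refine congrArg (starRingEnd ℂ) (congrArg _ (funext fun k ↦ congrArg x (Fin.ext ?_))) <;>
  simp [Fin.val_rev] <;> omega

theorem buStar_mul (a b : BUAlgebra D M) : buStar (a * b) = buStar b * buStar a := by
  induction a using DirectSum.induction_on with
  | zero => simp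
  | add a a' ha ha' => rw [add_mul, map_add, ha, ha', map_add, mul_add]
  | of i f =>
    induction b using DirectSum.induction_on with
    | zero => simp
    | add b b' hb hb' => rw [mul_add, map_add, hb, hb', map_add, add_mul]
    | of j g => exact buStar_of_mul f g

/-- The Borchers-Uhlmann algebra is a `*`-ring. -/
instance : StarRing (BUAlgebra D M) where
  star := buStar
  star_involutive a := by
    suffices h : (buStar (D := D) (M := M)).comp buStar = AddMonoidHom.id _ from
      DFunLike.congr_fun h a
    ext i f : 2
    simp only [AddMonoidHom.comp_apply, buStar, DirectSum.map_of, AddMonoidHom.id_apply]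
    refine congrArg _ (Subtype.ext (funext fun x ↦ ?_))
    refine (Complex.conj_conj _).trans
      (congrArg (f : (Fin i → M) → ℂ) (funext fun k ↦ congrArg x ?_))
    exact Fin.rev_rev k
  star_mul := buStar_mul
  star_add := map_add buStar

/-- The involution of the Borchers-Uhlmann algebra is antilinear. -/
instance : StarModule ℂ (BUAlgebra D M) where
  star_smul c a := by
    ext i : 1
    refine Subtype.ext (funext fun x ↦ ?_)
    exact map_mul (starRingEnd ℂ) _ _

/-- The quantum field `Φ : C₀^∞(M) → ⊕_n C₀^∞(M^n)`, `Φ(f) = 0 ⊕ f ⊕ 0 ⊕ ⋯`. -/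
def field : Test D M →ₗ[ℂ] BUAlgebra D M :=
  (DirectSum.lof ℂ ℕ (PowTest D M) 1).comp oneVar

/-- The two-sided `*`-ideal generated by a set. -/
def starIdeal (G : Set (BUAlgebra D M)) : TwoSidedIdeal (BUAlgebra D M) :=
  TwoSidedIdeal.span (G ∪ star '' G)

/-! ## States -/

variable (D M)

/-- A state on the Borchers-Uhlmann algebra: a normalised, positive linear functional that is
continuous for the direct sum (strict inductive limit) topology, i.e. whose restriction `ω_n` to
each summand `C₀^∞(M^n)` is a distribution on `M^n`. -/
structure BUState where
  /-- the underlying linear functional -/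
  toLin : BUAlgebra D M →ₗ[ℂ] ℂ
  continuous' : ∀ n, IsDistribution (toLin.comp (DirectSum.lof ℂ ℕ (PowTest D M) n))
  normalised : toLin 1 = 1
  positive : ∀ a, 0 ≤ (toLin (star a * a)).re ∧ (toLin (star a * a)).im = 0

variable {D M}

namespace BUState

variable (w : BUState D M)

/-- The `n`-point distribution `ω_n` on `M^n`. -/
def npoint (n : ℕ) : PowTest D M n →ₗ[ℂ] ℂ := w.toLin.comp (DirectSum.lof ℂ ℕ (PowTest D M) n)

/-- The antisymmetric part `ω_{2-}(x_2,x_1) = ½ (ω_2(x_2,x_1) - ω_2(x_1,x_2))`. -/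
def twoPointMinus : PowTest D M 2 →ₗ[ℂ] ℂ :=
  (1 / 2 : ℂ) • (w.npoint 2 - (w.npoint 2).comp (reverse 2))

/-- `ω` vanishes on the ideal `I`, i.e. descends to a state on the quotient algebra by `I`. -/
def DescendsToQuotient (I : TwoSidedIdeal (BUAlgebra D M)) : Prop := ∀ a ∈ I, w.toLin a = 0

/-- `ω` satisfies the commutation relations with commutator `E`, i.e. it descends to the quotient
by the `*`-ideal generated by the elements `f ⊗ h - h ⊗ f - i E(f,h) I`. -/
def HasCommutator (E : PowTest D M 2 →ₗ[ℂ] ℂ) : Prop :=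
  w.DescendsToQuotient (starIdeal {a | ∃ f h : Test D M,
    a = field f * field h - field h * field f - (Complex.I * E (tensor₂ f h)) • 1})

/-- `ω` is a generalised free field state: it satisfies the commutation relations with some
bi-distribution `E` as commutator. -/
def IsGeneralisedFreeField : Prop :=
  ∃ E : PowTest D M 2 →ₗ[ℂ] ℂ, IsDistribution E ∧ w.HasCommutator E

end BUState

end Power

/-! ## Free field states -/

section Free

variable {D : ℕ} {M : Type*} [TopologicalSpace M] [ChartedSpace (Coord D) M]
  [IsManifold 𝓘(ℝ, Coord D) ∞ M] (S : Spacetime D M) (m ξ : ℝ)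

namespace Spacetime

/-- A fundamental solution of the Klein-Gordon equation, as an operator
`G : C₀^∞(M) → C^∞(M)` with `K G f = f` and `G K f = f`. -/
def IsFundamentalSolution (G : Test D M →ₗ[ℂ] (M → ℂ)) : Prop :=
  (∀ f, ContMDiff 𝓘(ℝ, Coord D) 𝓘(ℝ, ℂ) ∞ (G f)) ∧
  (∀ f, S.kleinGordon m ξ (G f) = f) ∧
  (∀ f h : Test D M, (h : M → ℂ) = S.kleinGordon m ξ f → G h = f)

/-- The advanced fundamental solution: `supp (G f) ⊆ J⁻(supp f)`. -/
def IsAdvanced (G : Test D M →ₗ[ℂ] (M → ℂ)) : Prop :=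
  S.IsFundamentalSolution m ξ G ∧
    ∀ f : Test D M, tsupport (G f) ⊆ S.causalPast (tsupport (f : M → ℂ))

/-- The retarded fundamental solution: `supp (G f) ⊆ J⁺(supp f)`. -/
def IsRetarded (G : Test D M →ₗ[ℂ] (M → ℂ)) : Prop :=
  S.IsFundamentalSolution m ξ G ∧
    ∀ f : Test D M, tsupport (G f) ⊆ S.causalFuture (tsupport (f : M → ℂ))

/-- `E` is the bi-distribution `E_{m,ξ}`, the difference of the advanced and the retarded
fundamental solution: `E(f,h) = ∫ f (G_adv h - G_ret h) dvol`. -/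
def IsCausalPropagator [MeasurableSpace M] (E : PowTest D M 2 →ₗ[ℂ] ℂ) : Prop :=
  IsDistribution E ∧ ∃ Gadv Gret : Test D M →ₗ[ℂ] (M → ℂ),
    S.IsAdvanced m ξ Gadv ∧ S.IsRetarded m ξ Gret ∧
    ∀ f h : Test D M,
      E (tensor₂ f h) = ∫ x, (f : M → ℂ) x * (Gadv h x - Gret h x) ∂S.volumeMeasure

/-- The bi-distribution `T` satisfies the Klein-Gordon equation in both arguments. -/
def IsBisolution (T : PowTest D M 2 →ₗ[ℂ] ℂ) : Prop :=
  ∀ f k : Test D M, (k : M → ℂ) = S.kleinGordon m ξ f →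
    ∀ h : Test D M, T (tensor₂ k h) = 0 ∧ T (tensor₂ h k) = 0

end Spacetime

namespace BUState

variable (w : BUState D M)

/-- `ω` satisfies the Klein-Gordon equation: it descends to the quotient by the `*`-ideal
generated by the elements `K f` with `f ∈ C₀^∞(M)`. -/
def SatisfiesKleinGordon : Prop :=
  w.DescendsToQuotient (starIdeal {a | ∃ f k : Test D M,
    (k : M → ℂ) = S.kleinGordon m ξ f ∧ a = field k})

/-- `ω` is a free field state: it satisfies the Klein-Gordon equation and the commutation
relations with commutator `E_{m,ξ}`. -/
def IsFreeField [MeasurableSpace M] : Prop :=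
  w.SatisfiesKleinGordon S m ξ ∧
    ∃ E : PowTest D M 2 →ₗ[ℂ] ℂ, S.IsCausalPropagator m ξ E ∧ w.HasCommutator E

end BUState

end Free

end CurvedQFT

end

/-!
The commutator of a generalised free field state is a `c`-number that enters the commutation
relations only through its values on tensor products `f ⊗ h`, and there it is determined by the
antisymmetric part of the two-point distribution. So `E_{m,ξ}` is a commutator of the state
(`HasCommutator.of_twoPointMinus`).

For the Klein-Gordon equation let `k = K f`. As `ω₂` is a bisolution, `ω(Φ(k)* Φ(k)) = 0`, hence
`ω(X Φ(k)) = 0` for all `X` by the Cauchy-Schwarz inequality: `Φ(k)` annihilates the vacuum. Also by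
the bisolution property, the commutator of `Φ(k)` with any other field vanishes, so that `Φ(k)` can be
moved to the right through any product of fields, and `ω(X Φ(k) Φ(h_1) ⋯ Φ(h_n)) = 0`. The adjoints
of the generators are covered because `ω` is hermitian.

The algebra is larger than the one generated by the fields, as `C₀^∞(M^b)` contains more functions
than the sums of products `h_1 ⊗ ⋯ ⊗ h_b`. The passage from pure tensors to general elements rests on
their density, `IsDistribution.tensor_eq_zero_of_pureTensor`. By a partition of unity on `M` it is
enough to treat functions supported in a product of chart domains. In such coordinates a test
function is approximated, together with its derivatives, by linear combinations of exponentials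
`x ↦ exp (λ x)`, which are products of functions of the single arguments and remain so after
multiplication with a product of cutoff functions. To find them, mollify the function and replace the
mollifier by a linear combination of exponentials close to it (Stone-Weierstrass); the derivatives may
be put on the test function, so that uniform closeness of the kernels suffices, and the convolution of
a test function with an exponential is a multiple of that exponential
(`exists_span_expFun_near`). Changing charts costs only constants
(`exists_iteratedFDeriv_chart_le`).
-/

noncomputable section

namespace CurvedQFT

/-! ### Approximation of test functions on `ℝ^d` by exponentials -/

section Approximation

open MeasureTheory ContinuousLinearMap
open scoped Convolution

variable {E : Type*} [NormedAddCommGroup E] [NormedSpace ℝ E]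

/-- The real exponential functions `x ↦ exp (λ x)`, `λ` a linear functional, with complex values. -/
def expFun (l : E →L[ℝ] ℝ) (x : E) : ℂ := (Real.exp (l x) : ℂ)

theorem contDiff_expFun (l : E →L[ℝ] ℝ) : ContDiff ℝ ∞ (expFun l) :=
  Complex.ofRealCLM.contDiff.comp (Real.contDiff_exp.comp l.contDiff)

theorem contDiff_of_mem_span_expFun {P : E → ℂ}
    (hP : P ∈ Submodule.span ℂ (Set.range (expFun (E := E)))) : ContDiff ℝ ∞ P := by
  induction hP using Submodule.span_induction with
  | mem P h => obtain ⟨l, rfl⟩ := h; exact contDiff_expFun l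
  | zero => exact contDiff_const
  | add _ _ _ _ h h' => exact h.add h'
  | smul c _ _ h => exact h.const_smul c

/-- Exponentials are uniformly dense in the continuous functions on a compact set, by the
Stone-Weierstrass theorem. -/
theorem exists_span_exp_near {S : Set E} (hS : IsCompact S) {κ : E → ℝ} (hκ : Continuous κ)
    {ε : ℝ} (hε : 0 < ε) :
    ∃ q ∈ Submodule.span ℝ (Set.range fun (l : E →L[ℝ] ℝ) (x : E) ↦ Real.exp (l x)),
      ∀ x ∈ S, |q x - κ x| < ε := by
  let e : (E →L[ℝ] ℝ) → C(E, ℝ) := fun l ↦ ⟨fun x ↦ Real.exp (l x), by fun_prop⟩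
  obtain ⟨g, hg, hgS⟩ :=
    ContinuousMap.exists_mem_subalgebra_near_continuous_of_isCompact_of_separatesPoints
      (A := Algebra.adjoin ℝ (Set.range e)) (by
        intro x y hxy
        obtain ⟨l, hl⟩ := SeparatingDual.exists_separating_of_ne (R := ℝ) hxy
        exact ⟨_, ⟨e l, Algebra.subset_adjoin ⟨l, rfl⟩, rfl⟩, fun h ↦ hl (Real.exp_injective h)⟩)
      ⟨κ, hκ⟩ hS hε
  have hspan : g ∈ Submodule.span ℝ (Set.range e) := by
    have hclos : (Submonoid.closure (Set.range e) : Set C(E, ℝ)) = Set.range e := by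
      refine Set.Subset.antisymm (fun x hx ↦ ?_) Submonoid.subset_closure
      induction hx using Submonoid.closure_induction with
      | mem x h => exact h
      | one => exact ⟨0, ContinuousMap.ext fun x ↦ by simp [e]⟩
      | mul x y _ _ hx hy =>
        obtain ⟨l, rfl⟩ := hx
        obtain ⟨l', rfl⟩ := hy
        exact ⟨l + l', ContinuousMap.ext fun x ↦ by simp [e, Real.exp_add]⟩
    have h : g ∈ Subalgebra.toSubmodule (Algebra.adjoin ℝ (Set.range e)) := hg
    rwa [Algebra.adjoin_eq_span, hclos] at h
  refine ⟨g, ?_, fun x hx ↦ ?_⟩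
  · have := Submodule.mem_map_of_mem (f := ContinuousMap.coeFnLinearMap ℝ) hspan
    rw [Submodule.map_span, ← Set.range_comp] at this
    exact this
  · simpa [Real.norm_eq_abs] using hgS x hx

theorem convolution_linearIsometryEquiv_comp {E : Type*} [NormedAddCommGroup E]
    [MeasurableSpace E] (μ : Measure E) {V W : Type*} [NormedAddCommGroup V]
    [NormedSpace ℝ V] [NormedAddCommGroup W] [NormedSpace ℝ W] (e : V ≃ₗᵢ[ℝ] W) (q : E → ℝ) (g : E → V) :
    q ⋆[lsmul ℝ ℝ, μ] (e ∘ g) = e ∘ (q ⋆[lsmul ℝ ℝ, μ] g) := by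
  ext1 x
  simp only [convolution, lsmul_apply, Function.comp_apply]
  refine Eq.trans ?_ (e.toContinuousLinearEquiv.integral_comp_comm fun t ↦ q t • g (x - t))
  exact integral_congr_ae (.of_forall fun t ↦ (e.map_smul (q t) (g (x - t))).symm)

section Convolution

variable [FiniteDimensional ℝ E] [MeasurableSpace E] [BorelSpace E]
  (μ : Measure E) [μ.IsAddHaarMeasure]

theorem fderiv_convolution_lsmul {V : Type*} [NormedAddCommGroup V] [NormedSpace ℝ V] {g : E → V}
    (hg : ContDiff ℝ 1 g) (hgc : HasCompactSupport g) {q : E → ℝ} (hq : Continuous q) :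
    fderiv ℝ (q ⋆[lsmul ℝ ℝ, μ] g) = q ⋆[lsmul ℝ ℝ, μ] (fderiv ℝ g) := by
  ext1 x
  exact (hgc.hasFDerivAt_convolution_right (lsmul ℝ ℝ) hq.locallyIntegrable hg x).fderiv

/-- Derivatives of a convolution may be moved to the smooth factor. -/
theorem iteratedFDeriv_convolution {f : E → ℂ} (hf : ContDiff ℝ ∞ f) (hfc : HasCompactSupport f)
    {q : E → ℝ} (hq : Continuous q) (j : ℕ) :
    iteratedFDeriv ℝ j (q ⋆[lsmul ℝ ℝ, μ] f) = q ⋆[lsmul ℝ ℝ, μ] (iteratedFDeriv ℝ j f) := by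
  induction j with
  | zero =>
    rw [iteratedFDeriv_zero_eq_comp, iteratedFDeriv_zero_eq_comp,
      convolution_linearIsometryEquiv_comp]
  | succ j ih =>
    have hD : ContDiff ℝ 1 (iteratedFDeriv ℝ j f) :=
      hf.iteratedFDeriv_right (by exact_mod_cast le_top)
    rw [iteratedFDeriv_succ_eq_comp_left, iteratedFDeriv_succ_eq_comp_left, ih,
      fderiv_convolution_lsmul μ hD (hfc.iteratedFDeriv j) hq]
    exact (convolution_linearIsometryEquiv_comp μ (V := E →L[ℝ] E [×j]→L[ℝ] ℂ)
      (W := E [×(j + 1)]→L[ℝ] ℂ) (continuousMultilinearCurryLeftEquiv ℝ (fun _ : Fin (j + 1) ↦ E) ℂ).symm q _).symm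

/-- The convolution of a test function with a linear combination of exponentials is a linear
combination of exponentials. -/
theorem convolution_mem_span_expFun {f : E → ℂ} (hf : Continuous f) (hfc : HasCompactSupport f)
    {q : E → ℝ}
    (hq : q ∈ Submodule.span ℝ (Set.range fun (l : E →L[ℝ] ℝ) (x : E) ↦ Real.exp (l x))) :
    Continuous q ∧ q ⋆[lsmul ℝ ℝ, μ] f ∈ Submodule.span ℂ (Set.range (expFun (E := E))) := by
  induction hq using Submodule.span_induction with
  | mem q h =>
    obtain ⟨l, rfl⟩ := h
    refine ⟨by fun_prop, ?_⟩
    have : (fun x ↦ Real.exp (l x)) ⋆[lsmul ℝ ℝ, μ] f =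
        (∫ y, Real.exp (-l y) • f y ∂μ) • expFun l := by
      ext x
      rw [← convolution_flip, convolution]
      simp only [flip_apply, lsmul_apply, Pi.smul_apply, smul_eq_mul, expFun]
      rw [← integral_mul_const]
      refine integral_congr_ae (.of_forall fun y ↦ ?_)
      simp [sub_eq_add_neg, Real.exp_add, Complex.real_smul]
      ring
    rw [this]
    exact Submodule.smul_mem _ _ (Submodule.subset_span ⟨l, rfl⟩)
  | zero =>
    refine ⟨continuous_zero, ?_⟩
    rw [zero_convolution]
    exact Submodule.zero_mem _
  | add p q _ _ hp hq =>
    refine ⟨hp.1.add hq.1, ?_⟩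
    rw [ConvolutionExists.add_distrib
      (hfc.convolutionExists_right _ hp.1.locallyIntegrable hf)
      (hfc.convolutionExists_right _ hq.1.locallyIntegrable hf)]
    exact Submodule.add_mem _ hp.2 hq.2
  | smul c q _ hq =>
    refine ⟨hq.1.const_smul c, ?_⟩
    rw [smul_convolution]
    exact Submodule.smul_of_tower_mem _ c hq.2

/-- If two kernels are uniformly close on `S - supp g`, their convolutions with `g` are uniformly
close on `S`. -/
theorem dist_convolution_le_of_near {V : Type*} [NormedAddCommGroup V] [NormedSpace ℝ V]
    {g : E → V} (hg : Continuous g) (hgc : HasCompactSupport g) {q κ : E → ℝ}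
    (hq : Continuous q) (hκ : Continuous κ) {ε : ℝ} {x : E}
    (h : ∀ y ∈ tsupport g, |q (x - y) - κ (x - y)| ≤ ε) :
    dist ((q ⋆[lsmul ℝ ℝ, μ] g) x) ((κ ⋆[lsmul ℝ ℝ, μ] g) x) ≤ ε * ∫ y, ‖g y‖ ∂μ := by
  have e1 := hgc.convolutionExists_left (lsmul ℝ ℝ).flip (μ := μ) hg hq.locallyIntegrable
  have e2 := hgc.convolutionExists_left (lsmul ℝ ℝ).flip (μ := μ) hg hκ.locallyIntegrable
  rw [dist_eq_norm, ← convolution_flip, ← convolution_flip (f := κ), convolution, convolution,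
    ← integral_sub (e1 x) (e2 x), ← integral_const_mul]
  refine norm_integral_le_of_norm_le ((hg.integrable_of_hasCompactSupport hgc).norm.const_mul ε)
    (.of_forall fun y ↦ ?_)
  by_cases hy : y ∈ tsupport g
  · simp only [flip_apply, lsmul_apply, ← sub_smul, norm_smul, Real.norm_eq_abs]
    exact mul_le_mul_of_nonneg_right (h y hy) (norm_nonneg _)
  · simp [image_eq_zero_of_notMem_tsupport hy]

end Convolution

/-- Linear combinations of exponentials approximate a test function together with its derivatives
up to any given order, uniformly on compact sets. -/
theorem exists_span_expFun_near [FiniteDimensional ℝ E] {f : E → ℂ} (hf : ContDiff ℝ ∞ f) (hfc : HasCompactSupport f)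
    {S : Set E} (hS : IsCompact S) (m : ℕ) {ε : ℝ} (hε : 0 < ε) :
    ∃ P ∈ Submodule.span ℂ (Set.range (expFun (E := E))),
      ∀ j ≤ m, ∀ x ∈ S, ‖iteratedFDeriv ℝ j (fun z ↦ f z - P z) x‖ ≤ ε := by
  let _ : MeasurableSpace E := borel E
  have : BorelSpace E := ⟨rfl⟩
  let μ : Measure E := Measure.addHaar
  have hD (j : ℕ) : Continuous (iteratedFDeriv ℝ j f) := hf.continuous_iteratedFDeriv (by exact_mod_cast le_top)
  have hDc (j : ℕ) : HasCompactSupport (iteratedFDeriv ℝ j f) := hfc.iteratedFDeriv j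
  -- a mollifier whose radius serves all derivatives up to order `m`
  have hδ : ∃ δ > 0, ∀ j ≤ m, ∀ x y, dist x y < δ →
      dist (iteratedFDeriv ℝ j f x) (iteratedFDeriv ℝ j f y) < ε / 2 := by
    have (j : ℕ) := Metric.uniformContinuous_iff.1
      ((hDc j).uniformContinuous_of_continuous (hD j)) (ε / 2) (by positivity)
    choose δ hδ h using this
    refine ⟨(Finset.range (m + 1)).inf' ⟨0, by simp⟩ δ, ?_, fun j hj x y hxy ↦ h j ?_⟩
    · exact (Finset.lt_inf'_iff _).2 fun j _ ↦ hδ j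
    · exact hxy.trans_le (Finset.inf'_le _ (by simpa using Nat.lt_succ_of_le hj))
  obtain ⟨δ, hδ0, hδ⟩ := hδ
  let φ : ContDiffBump (0 : E) := ⟨δ / 2, δ, by positivity, by linarith⟩
  have hκ : Continuous (φ.normed μ) := φ.continuous_normed
  let A : ℝ := ∑ j ∈ Finset.range (m + 1), ∫ y, ‖iteratedFDeriv ℝ j f y‖ ∂μ
  have hA0 (j : ℕ) : 0 ≤ ∫ y, ‖iteratedFDeriv ℝ j f y‖ ∂μ := integral_nonneg fun _ ↦ norm_nonneg _
  have hA : 0 ≤ A := Finset.sum_nonneg fun j _ ↦ hA0 j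
  obtain ⟨q, hq, hqκ⟩ := exists_span_exp_near
    ((hS.prod hfc.isCompact).image (continuous_fst.sub continuous_snd)) hκ
    (ε := ε / (2 * (A + 1))) (by positivity)
  obtain ⟨hqc, hP⟩ := convolution_mem_span_expFun μ hf.continuous hfc hq
  refine ⟨_, hP, fun j hj x hx ↦ ?_⟩
  have hsub : iteratedFDeriv ℝ j (fun z ↦ f z - (q ⋆[lsmul ℝ ℝ, μ] f) z) x =
      iteratedFDeriv ℝ j f x - iteratedFDeriv ℝ j (q ⋆[lsmul ℝ ℝ, μ] f) x := by
    refine iteratedFDeriv_sub_apply (hf.contDiffAt.of_le (by exact_mod_cast le_top))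
      ((contDiff_of_mem_span_expFun hP).contDiffAt.of_le (by exact_mod_cast le_top))
  rw [hsub, iteratedFDeriv_convolution μ hf hfc hqc, norm_sub_rev, ← dist_eq_norm]
  have h1 := dist_convolution_le_of_near μ (hD j) (hDc j) hqc hκ (x := x)
    (ε := ε / (2 * (A + 1))) fun y hy ↦
      (hqκ _ ⟨(x, y), ⟨hx, tsupport_iteratedFDeriv_subset (𝕜 := ℝ) j hy⟩, rfl⟩).le
  have h2 : dist ((φ.normed μ ⋆[lsmul ℝ ℝ, μ] iteratedFDeriv ℝ j f) x) (iteratedFDeriv ℝ j f x)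
      ≤ ε / 2 :=
    φ.dist_normed_convolution_le (hD j).aestronglyMeasurable fun y hy ↦ (hδ j hj y x hy).le
  have h3 : ε / (2 * (A + 1)) * ∫ y, ‖iteratedFDeriv ℝ j f y‖ ∂μ ≤ ε / 2 := by
    have hle : ∫ y, ‖iteratedFDeriv ℝ j f y‖ ∂μ ≤ A + 1 :=
      (Finset.single_le_sum (f := fun j ↦ ∫ y, ‖iteratedFDeriv ℝ j f y‖ ∂μ)
        (fun j _ ↦ hA0 j) (Finset.mem_range.2 (Nat.lt_succ_of_le hj))).trans (by linarith)
    refine (mul_le_mul_of_nonneg_left hle (by positivity)).trans (le_of_eq ?_)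
    field_simp
  linarith [dist_triangle ((q ⋆[lsmul ℝ ℝ, μ] iteratedFDeriv ℝ j f) x)
    ((φ.normed μ ⋆[lsmul ℝ ℝ, μ] iteratedFDeriv ℝ j f) x) (iteratedFDeriv ℝ j f x)]

end Approximation

/-! ### Derivatives in charts, and the manifold `M^n` -/

section ChartBounds

variable {F H : Type*} [NormedAddCommGroup F] [NormedSpace ℝ F] [TopologicalSpace H]
  {J : ModelWithCorners ℝ F H} [J.Boundaryless] {N : Type*} [TopologicalSpace N]
  [ChartedSpace H N] [IsManifold J ∞ N]

/-- For fixed smooth `G` and `τ`, the derivatives of `u = G · (h ∘ τ)` in a chart are bounded,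
uniformly on compact sets, by those of `h`, provided that the support of `u` stays in a fixed
closed subset `K` of the open set `U` on which `G` and `τ` are smooth. Only the values of the
derivatives of `h` on `τ(K)` matter. -/
theorem exists_iteratedFDeriv_chart_le {E : Type*} [NormedAddCommGroup E] [NormedSpace ℝ E]
    (p : N) {L : Set F} (hL : IsCompact L) (hLt : L ⊆ (extChartAt J p).target) (k : ℕ)
    {U K : Set N} (hU : IsOpen U) (hK : IsClosed K) (hKU : K ⊆ U)
    {G : N → ℂ} (hG : ContMDiffOn J 𝓘(ℝ, ℂ) ∞ G U)
    {τ : N → E} (hτ : ContMDiffOn J 𝓘(ℝ, E) ∞ τ U) :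
    ∃ R : ℝ, 0 ≤ R ∧ ∀ h : E → ℂ, ContDiff ℝ ∞ h → ∀ B : ℝ, 0 ≤ B →
      (∀ j ≤ k, ∀ x ∈ K, ‖iteratedFDeriv ℝ j h (τ x)‖ ≤ B) →
      ∀ u : N → ℂ, tsupport u ⊆ K → (∀ x ∈ U, u x = G x * h (τ x)) →
      ∀ y ∈ L, ‖iteratedFDeriv ℝ k (fun z ↦ u ((extChartAt J p).symm z)) y‖ ≤ R * B := by
  have hle (n : ℕ) : (n : ℕ∞ω) ≤ ∞ := by exact_mod_cast le_top
  set ψ := extChartAt J p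
  have hψ : ContMDiffOn 𝓘(ℝ, F) J ∞ ψ.symm ψ.target := contMDiffOn_extChartAt_symm p
  set V : Set F := ψ.target ∩ ψ.symm ⁻¹' U
  have ht : IsOpen ψ.target := isOpen_extChartAt_target p
  have hV : IsOpen V := hψ.continuousOn.isOpen_inter_preimage ht hU
  have hg : ContDiffOn ℝ ∞ (G ∘ ψ.symm) V :=
    (hG.comp (hψ.mono Set.inter_subset_left) fun _ h ↦ h.2).contDiffOn
  have hσ : ContDiffOn ℝ ∞ (τ ∘ ψ.symm) V :=
    (hτ.comp (hψ.mono Set.inter_subset_left) fun _ h ↦ h.2).contDiffOn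
  set L' : Set F := L ∩ ψ.symm ⁻¹' K
  have hL' : IsCompact L' := hL.of_isClosed_subset
    ((hψ.continuousOn.mono hLt).preimage_isClosed_of_isClosed hL.isClosed hK) Set.inter_subset_left
  have hL'V : L' ⊆ V := fun y hy ↦ ⟨hLt hy.1, hKU hy.2⟩
  have hbd {W : Type _} [NormedAddCommGroup W] [NormedSpace ℝ W] {a : F → W}
      (ha : ContDiffOn ℝ ∞ a V) :
      ∃ C : ℕ → ℝ, ∀ j, 0 ≤ C j ∧ ∀ y ∈ L', ‖iteratedFDerivWithin ℝ j a V y‖ ≤ C j := by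
    have (j : ℕ) : ∃ C : ℝ, 0 ≤ C ∧ ∀ y ∈ L', ‖iteratedFDerivWithin ℝ j a V y‖ ≤ C := by
      obtain ⟨C, hC⟩ := hL'.exists_bound_of_continuousOn
        ((ha.continuousOn_iteratedFDerivWithin (m := j) (hle _)
          hV.uniqueDiffOn).mono hL'V)
      exact ⟨max C 0, le_max_right _ _, fun y hy ↦ (hC y hy).trans (le_max_left _ _)⟩
    choose C hC using this
    exact ⟨C, hC⟩
  obtain ⟨Cg, hCg⟩ := hbd hg
  have hbd' : ∃ A : ℝ, 1 ≤ A ∧ ∀ j ≤ k, ∀ y ∈ L',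
      ‖iteratedFDerivWithin ℝ j (τ ∘ ψ.symm) V y‖ ≤ A := by
    have (j : ℕ) := hL'.exists_bound_of_continuousOn
        ((hσ.continuousOn_iteratedFDerivWithin (m := j) (hle _)
          hV.uniqueDiffOn).mono hL'V)
    choose C hC using this
    refine ⟨1 + ∑ j ∈ Finset.range (k + 1), |C j|,
      le_add_of_nonneg_right (Finset.sum_nonneg fun _ _ ↦ abs_nonneg _), fun j hj y hy ↦ ?_⟩
    have := Finset.single_le_sum (f := fun j ↦ |C j|) (fun _ _ ↦ abs_nonneg _)
      (Finset.mem_range.2 (Nat.lt_succ_of_le hj))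
    linarith [hC j y hy, le_abs_self (C j)]
  obtain ⟨A, hA1, hA⟩ := hbd'
  have hA0 : 0 ≤ A := zero_le_one.trans hA1
  refine ⟨∑ i ∈ Finset.range (k + 1), (k.choose i : ℝ) * Cg i *
    ((k - i).factorial * A ^ (k - i)), ?_, ?_⟩
  · exact Finset.sum_nonneg fun i _ ↦ mul_nonneg (mul_nonneg (by positivity) (hCg i).1)
      (by positivity)
  intro h hh B hB hhB u hu huG y hy
  by_cases hyK : ψ.symm y ∈ K
  · have hyL' : y ∈ L' := ⟨hy, hyK⟩
    have hyV : y ∈ V := hL'V hyL'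
    have heq : iteratedFDeriv ℝ k (fun z ↦ u (ψ.symm z)) y =
        iteratedFDerivWithin ℝ k (fun z ↦ (G ∘ ψ.symm) z * (h ∘ (τ ∘ ψ.symm)) z) V y := by
      rw [← iteratedFDerivWithin_of_isOpen k hV hyV]
      exact iteratedFDerivWithin_congr (fun z hz ↦ huG _ hz.2) hyV k
    rw [heq, Finset.sum_mul]
    refine (norm_iteratedFDerivWithin_mul_le hg (hh.comp_contDiffOn hσ) hV.uniqueDiffOn hyV
      (hle _)).trans (Finset.sum_le_sum fun i hi ↦ ?_)
    have hcomp : ‖iteratedFDerivWithin ℝ (k - i) (h ∘ (τ ∘ ψ.symm)) V y‖ ≤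
        (k - i).factorial * B * A ^ (k - i) := by
      refine norm_iteratedFDerivWithin_comp_le (N := ∞) (t := Set.univ) hh.contDiffOn hσ
        (hle _) uniqueDiffOn_univ hV.uniqueDiffOn (Set.mapsTo_univ _ _) hyV
        (fun j hj ↦ ?_) (fun j hj1 hj ↦ ?_)
      · rw [iteratedFDerivWithin_univ]
        exact hhB j (hj.trans (Nat.sub_le _ _)) _ hyK
      · exact (hA j (hj.trans (Nat.sub_le _ _)) y hyL').trans
          (le_self_pow₀ hA1 (Nat.one_le_iff_ne_zero.1 hj1))
    calc (k.choose i : ℝ) * ‖iteratedFDerivWithin ℝ i (G ∘ ψ.symm) V y‖ *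
          ‖iteratedFDerivWithin ℝ (k - i) (h ∘ (τ ∘ ψ.symm)) V y‖
        ≤ (k.choose i : ℝ) * Cg i * ((k - i).factorial * B * A ^ (k - i)) := by
          refine mul_le_mul (mul_le_mul_of_nonneg_left ((hCg i).2 y hyL') (by positivity)) hcomp
            (norm_nonneg _) (mul_nonneg (by positivity) (hCg i).1)
      _ = _ := by ring
  · have hz : (fun z ↦ u (ψ.symm z)) =ᶠ[nhds y] fun _ ↦ 0 := by
      filter_upwards [(hψ.continuousOn.isOpen_inter_preimage ht
        hK.isOpen_compl).mem_nhds ⟨hLt hy, hyK⟩] with z hz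
      exact image_eq_zero_of_notMem_tsupport fun h ↦ hz.2 (hu h)
    rw [(hz.iteratedFDeriv ℝ k).self_of_nhds]
    have : iteratedFDeriv ℝ k (fun _ : F ↦ (0 : ℂ)) y = 0 := by
      simp
    rw [this, norm_zero]
    exact mul_nonneg (Finset.sum_nonneg fun i _ ↦
      mul_nonneg (mul_nonneg (by positivity) (hCg i).1) (by positivity)) hB

/-- A smooth function whose compact support lies in the domain of a chart, written in the chart
and extended by zero, is a test function on the model space. -/
theorem exists_chart_extension {f : N → ℂ} (hf : ContMDiff J 𝓘(ℝ, ℂ) ∞ f)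
    (hfc : HasCompactSupport f) (q : N) (hq : tsupport f ⊆ (extChartAt J q).source) :
    ∃ g : F → ℂ, ContDiff ℝ ∞ g ∧ HasCompactSupport g ∧
      ∀ x ∈ (extChartAt J q).source, g (extChartAt J q x) = f x := by
  classical
  set φ := extChartAt J q
  have hK : IsCompact (φ '' tsupport f) :=
    hfc.isCompact.image_of_continuousOn ((continuousOn_extChartAt q).mono hq)
  let g : F → ℂ := φ.target.indicator fun z ↦ f (φ.symm z)
  have hg0 (z : F) (hz : z ∉ φ '' tsupport f) : g z = 0 := by
    by_cases hzt : z ∈ φ.target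
    · refine (Set.indicator_of_mem hzt _).trans ?_
      exact image_eq_zero_of_notMem_tsupport fun h ↦ hz ⟨_, h, φ.right_inv hzt⟩
    · exact Set.indicator_of_notMem hzt _
  refine ⟨g, ?_, HasCompactSupport.intro hK hg0, fun x hx ↦ ?_⟩
  · rw [contDiff_iff_contDiffAt]
    intro z
    by_cases hz : z ∈ φ '' tsupport f
    · have hzt : φ.target ∈ nhds z := by
        obtain ⟨x, hx, rfl⟩ := hz
        exact (isOpen_extChartAt_target q).mem_nhds (φ.map_source (hq hx))
      have h1 : ContDiffAt ℝ ∞ (f ∘ φ.symm) z :=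
        ((hf.comp_contMDiffOn (contMDiffOn_extChartAt_symm q)).contDiffOn).contDiffAt hzt
      refine h1.congr_of_eventuallyEq ?_
      filter_upwards [hzt] with y hy
      exact Set.indicator_of_mem hy _
    · refine contDiffAt_const (c := (0 : ℂ)) |>.congr_of_eventuallyEq ?_
      filter_upwards [hK.isClosed.isOpen_compl.mem_nhds hz] with y hy
      exact hg0 y hy
  · exact (Set.indicator_of_mem (φ.map_source hx) _).trans (congrArg f (φ.left_inv hx))

end ChartBounds

section PowManifold

variable {D : ℕ} {M : Type*} [TopologicalSpace M] [ChartedSpace (Coord D) M]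

instance powModel_boundaryless (n : ℕ) : (powModel D n).Boundaryless :=
  ⟨Set.eq_univ_of_forall fun z ↦ ⟨z, rfl⟩⟩

instance isManifold_pow [IsManifold 𝓘(ℝ, Coord D) ∞ M] (n : ℕ) :
    IsManifold (powModel D n) ∞ (Fin n → M) := by
  refine isManifold_of_contDiffOn _ _ _ ?_
  rintro _ _ ⟨e, he, rfl⟩ ⟨e', he', rfl⟩
  rw [contDiffOn_pi]
  intro i
  have hi : ContDiffOn ℝ ∞ ((e i).symm ≫ₕ e' i) ((e i).symm ≫ₕ e' i).source := by
    have h := HasGroupoid.compatible (G := contDiffGroupoid ∞ 𝓘(ℝ, Coord D))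
      (he i (Set.mem_univ i)) (he' i (Set.mem_univ i))
    rw [contDiffGroupoid, mem_groupoid_of_pregroupoid] at h
    simpa [contDiffPregroupoid] using h.1
  refine hi.comp (t := ((e i).symm ≫ₕ e' i).source) (f := fun z : Fin n → Coord D ↦ z i)
    (by fun_prop) fun z hz ↦ ?_
  have h1 := hz.1
  exact ⟨h1.1 i (Set.mem_univ i), h1.2 i (Set.mem_univ i)⟩

end PowManifold

/-! ### Density of pure tensors -/

section Density

variable {D : ℕ} {M : Type*} [TopologicalSpace M] [ChartedSpace (Coord D) M]

theorem contMDiff_prod_proj {n : ℕ} {f : Fin n → M → ℂ}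
    (hf : ∀ i, ContMDiff 𝓘(ℝ, Coord D) 𝓘(ℝ, ℂ) ∞ (f i)) :
    ContMDiff (powModel D n) 𝓘(ℝ, ℂ) ∞ fun x : Fin n → M ↦ ∏ i, f i (x i) :=
  (contDiff_prod fun i _ ↦ contDiff_apply ℝ ℂ i).contMDiff.comp
    (contMDiff_pi_space.2 fun i ↦ (hf i).comp (contMDiff_proj i))

/-- The function `f_0 ⊗ ⋯ ⊗ f_{n-1}` on `M^n`. -/
def pureTensor {n : ℕ} (f : Fin n → Test D M) : PowTest D M n :=
  ⟨fun x ↦ ∏ i, (f i : M → ℂ) (x i), contMDiff_prod_proj fun i ↦ (f i).2.1, by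
    refine (isCompact_univ_pi fun i ↦ (f i).2.2.isCompact).of_isClosed_subset
      (isClosed_tsupport _) (closure_minimal (fun x hx i _ ↦ ?_)
        (isClosed_set_pi fun i _ ↦ isClosed_tsupport _))
    exact subset_tsupport _ (Finset.prod_ne_zero_iff.1 hx i (Finset.mem_univ i))⟩

/-- `f ⊗ g` as a linear function of `g`. -/
def tensorLeft {a b : ℕ} (f : PowTest D M a) : PowTest D M b →ₗ[ℂ] PowTest D M (a + b) where
  toFun := tensor f
  map_add' _ _ := Subtype.ext (funext fun _ ↦ mul_add _ _ _)
  map_smul' _ _ := Subtype.ext (funext fun _ ↦ mul_left_comm _ _ _)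

/-- The product of a test function and a smooth function. -/
def PowTest.smoothMul {n : ℕ} (g : (Fin n → M) → ℂ)
    (hg : ContMDiff (powModel D n) 𝓘(ℝ, ℂ) ∞ g) (f : PowTest D M n) : PowTest D M n :=
  ⟨fun x ↦ g x * (f : (Fin n → M) → ℂ) x, contDiff_mul.contMDiff.comp (hg.prodMk_space f.2.1),
    f.2.2.mul_left⟩

variable [IsManifold 𝓘(ℝ, Coord D) ∞ M]

/-- In the chart around `q`, an exponential function with a product cutoff factorises. -/
theorem exists_pureTensor_eq_expFun {n : ℕ} (q : Fin n → M) (χ : Fin n → Test D M)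
    (hχ : ∀ i, tsupport (χ i : M → ℂ) ⊆ (chartAt (Coord D) (q i)).source)
    (l : (Fin n → Coord D) →L[ℝ] ℝ) :
    ∃ f : Fin n → Test D M, ∀ x : Fin n → M, (pureTensor f : (Fin n → M) → ℂ) x =
      (∏ i, (χ i : M → ℂ) (x i)) * expFun l (extChartAt (powModel D n) q x) := by
  have hsm (i : Fin n) : ContMDiff 𝓘(ℝ, Coord D) 𝓘(ℝ, ℂ) ∞ fun x : M ↦ (χ i : M → ℂ) x *
      expFun (l.comp (ContinuousLinearMap.single ℝ (fun _ : Fin n ↦ Coord D) i))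
        (extChartAt 𝓘(ℝ, Coord D) (q i) x) := by
    refine contMDiff_of_tsupport fun x hx ↦ ?_
    have hx' : x ∈ (chartAt (Coord D) (q i)).source := hχ i (tsupport_mul_subset_left hx)
    refine contDiff_mul.contMDiff.contMDiffAt.comp x
      (((χ i).2.1.contMDiffAt).prodMk_space ?_)
    exact (contDiff_expFun _).contMDiff.contMDiffAt.comp x (contMDiffAt_extChartAt' hx')
  refine ⟨fun i ↦ ⟨_, hsm i, (χ i).2.2.mul_right⟩, fun x ↦ ?_⟩
  have hl : l (extChartAt (powModel D n) q x) =
      ∑ i, l (ContinuousLinearMap.single ℝ (fun _ : Fin n ↦ Coord D) i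
        (extChartAt 𝓘(ℝ, Coord D) (q i) (x i))) := by
    rw [← map_sum]
    exact congrArg l (Finset.univ_sum_single
      (fun i ↦ extChartAt 𝓘(ℝ, Coord D) (q i) (x i))).symm
  change ∏ i, ((χ i : M → ℂ) (x i) * _) = _
  rw [Finset.prod_mul_distrib]
  congr 1
  simp only [expFun, hl, Real.exp_sum, Complex.ofReal_prod]
  rfl

variable [T2Space M] [SecondCountableTopology M]

/-- Smooth cutoff functions: a test function that is `1` on a compact set and supported in a given
neighbourhood of it. -/
theorem exists_test_eq_one {K U : Set M} (hK : IsCompact K) (hU : IsOpen U) (hKU : K ⊆ U) :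
    ∃ χ : Test D M, tsupport (χ : M → ℂ) ⊆ U ∧ ∀ x ∈ K, (χ : M → ℂ) x = 1 := by
  have : LocallyCompactSpace M := ChartedSpace.locallyCompactSpace (Coord D) M
  obtain ⟨K', hK', hKK', hK'U⟩ := exists_compact_between hK hU hKU
  obtain ⟨χ, h0, h1, -⟩ := exists_contMDiffMap_zero_one_of_isClosed (n := ⊤) 𝓘(ℝ, Coord D)
    isOpen_interior.isClosed_compl hK.isClosed (s := (interior K')ᶜ)
    (Set.disjoint_left.2 fun x hx hxK ↦ hx (hKK' hxK))
  have hsub : tsupport (fun x ↦ (χ x : ℂ)) ⊆ K' := by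
    refine closure_minimal (fun x hx ↦ ?_) hK'.isClosed
    by_contra hxK
    refine hx ?_
    have : χ x = 0 := h0 fun h ↦ hxK (interior_subset h)
    simp [this]
  refine ⟨⟨fun x ↦ (χ x : ℂ), Complex.ofRealCLM.contDiff.contMDiff.comp χ.contMDiff,
    hK'.of_isClosed_subset (isClosed_tsupport _) hsub⟩, hsub.trans hK'U, fun x hx ↦ ?_⟩
  have : χ x = 1 := h1 hx
  simp [this]

/-- The local form of the density of pure tensors, for a second factor supported in a product of
chart domains. -/
theorem IsDistribution.tensor_eq_zero_of_tsupport_subset {a b : ℕ}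
    {T : PowTest D M (a + b) →ₗ[ℂ] ℂ} (hT : IsDistribution T) (A : PowTest D M a)
    (h0 : ∀ f : Fin b → Test D M, T (tensor A (pureTensor f)) = 0) (q : Fin b → M)
    {K : Fin b → Set M} (hK : ∀ i, IsCompact (K i))
    (hKq : ∀ i, K i ⊆ (chartAt (Coord D) (q i)).source) (B : PowTest D M b)
    (hB : tsupport (B : (Fin b → M) → ℂ) ⊆ Set.univ.pi K) : T (tensor A B) = 0 := by
  choose χ hχs hχ1 using fun i ↦ exists_test_eq_one (D := D) (hK i)
    (chartAt (Coord D) (q i)).open_source (hKq i)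
  set φ := extChartAt (powModel D b) q
  have hφ (x : Fin b → M) : x ∈ φ.source ↔ ∀ i, x i ∈ (chartAt (Coord D) (q i)).source := by
    simp [φ]
  obtain ⟨f, hf, hfc, hfB⟩ := exists_chart_extension B.2.1 B.2.2 q fun x hx ↦
    (hφ x).2 fun i ↦ hKq i (hB hx i (Set.mem_univ i))
  let X : (Fin b → M) → ℂ := fun x ↦ ∏ i, (χ i : M → ℂ) (x i)
  have hX : ContMDiff (powModel D b) 𝓘(ℝ, ℂ) ∞ X := contMDiff_prod_proj fun i ↦ (χ i).2.1
  let K₁ : Set (Fin b → M) := Set.univ.pi fun i ↦ tsupport (χ i : M → ℂ)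
  have hK₁ : IsCompact K₁ := isCompact_univ_pi fun i ↦ (χ i).2.2.isCompact
  have hX0 (x : Fin b → M) (hx : x ∉ K₁) : X x = 0 := by
    by_contra h
    exact hx fun i _ ↦ subset_tsupport _ (Finset.prod_ne_zero_iff.1 h i (Finset.mem_univ i))
  have hK₁φ : K₁ ⊆ φ.source := fun x hx ↦ (hφ x).2 fun i ↦ hχs i (hx i (Set.mem_univ i))
  have hXB (x : Fin b → M) (hx : x ∈ φ.source) :
      (B : (Fin b → M) → ℂ) x = X x * f (φ x) := by
    rw [hfB x hx]
    by_cases hxB : x ∈ tsupport (B : (Fin b → M) → ℂ)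
    · rw [show X x = 1 from
        Finset.prod_eq_one fun i _ ↦ hχ1 i _ (hB hxB i (Set.mem_univ i)), one_mul]
    · rw [image_eq_zero_of_notMem_tsupport hxB, mul_zero]
  -- the two projections of `M^(a+b)`
  let π₁ : (Fin (a + b) → M) → Fin a → M := fun x i ↦ x (Fin.castAdd b i)
  let π₂ : (Fin (a + b) → M) → Fin b → M := fun x i ↦ x (Fin.natAdd a i)
  have hπ₁ : ContMDiff (powModel D (a + b)) (powModel D a) ∞ π₁ :=
    contMDiff_reindex (Fin.castAdd b)
  have hπ₂ : ContMDiff (powModel D (a + b)) (powModel D b) ∞ π₂ :=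
    contMDiff_reindex (Fin.natAdd a)
  let Q : Set (Fin (a + b) → M) :=
    {x | π₁ x ∈ tsupport (A : (Fin a → M) → ℂ) ∧ π₂ x ∈ K₁}
  have hQc : IsClosed Q := ((isClosed_tsupport _).preimage hπ₁.continuous).inter
    (hK₁.isClosed.preimage hπ₂.continuous)
  have hQ : IsCompact Q :=
    ((A.2.2.isCompact.prod hK₁).image (Fin.continuous_append (X := M) a b)).of_isClosed_subset hQc
      fun x hx ↦ ⟨(_, _), ⟨hx.1, hx.2⟩, Fin.append_castAdd_natAdd⟩
  obtain ⟨s, c, hs, hsT⟩ := hT Q hQ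
  let U : Set (Fin (a + b) → M) := π₂ ⁻¹' φ.source
  have hU : IsOpen U := (isOpen_extChartAt_source q).preimage hπ₂.continuous
  have hQU : Q ⊆ U := fun x hx ↦ hK₁φ hx.2
  have hG : ContMDiff (powModel D (a + b)) 𝓘(ℝ, ℂ) ∞
      fun x ↦ (A : (Fin a → M) → ℂ) (π₁ x) * X (π₂ x) :=
    contDiff_mul.contMDiff.comp ((A.2.1.comp hπ₁).prodMk_space (hX.comp hπ₂))
  have hτ : ContMDiffOn (powModel D (a + b)) 𝓘(ℝ, Fin b → Coord D) ∞ (fun x ↦ φ (π₂ x)) U :=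
    (contMDiffOn_extChartAt (I := powModel D b) (x := q)).comp hπ₂.contMDiffOn fun x hx ↦ by
      have hx' : π₂ x ∈ φ.source := hx
      rwa [extChartAt_source] at hx'
  have hR (i : (Fin (a + b) → M) × Set (Fin (a + b) → Coord D) × ℕ) (hi : i ∈ s) :=
    exists_iteratedFDeriv_chart_le i.1 (hs i hi).1 (hs i hi).2 i.2.2 hU hQc hQU
      hG.contMDiffOn hτ
  choose! R hR0 hR using hR
  let m := s.sup fun i ↦ i.2.2
  have hR' : 0 ≤ ∑ i ∈ s, R i := Finset.sum_nonneg hR0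
  -- products of cutoffs and exponentials are pure tensors
  have hspan (P : (Fin b → Coord D) → ℂ) (hP : P ∈ Submodule.span ℂ (Set.range expFun)) :
      ∃ u : PowTest D M b, (∀ x, (u : (Fin b → M) → ℂ) x = X x * P (φ x)) ∧
        T (tensor A u) = 0 := by
    induction hP using Submodule.span_induction with
    | mem P h =>
      obtain ⟨l, rfl⟩ := h
      obtain ⟨v, hv⟩ := exists_pureTensor_eq_expFun q χ hχs l
      exact ⟨_, hv, h0 v⟩
    | zero => exact ⟨0, fun x ↦ (mul_zero _).symm, by
        rw [show tensor A (0 : PowTest D M b) = 0 from (tensorLeft A).map_zero, map_zero]⟩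
    | add P P' _ _ h h' =>
      obtain ⟨u, hu, hu0⟩ := h
      obtain ⟨u', hu', hu0'⟩ := h'
      refine ⟨u + u', fun x ↦ ?_, ?_⟩
      · exact (congrArg₂ (· + ·) (hu x) (hu' x)).trans (mul_add _ _ _).symm
      · rw [show tensor A (u + u') = tensor A u + tensor A u' from (tensorLeft A).map_add u u',
          map_add, hu0, hu0', add_zero]
    | smul c P _ h =>
      obtain ⟨u, hu, hu0⟩ := h
      refine ⟨c • u, fun x ↦ ?_, ?_⟩
      · exact (congrArg (c * ·) (hu x)).trans (mul_left_comm _ _ _)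
      · rw [show tensor A (c • u) = c • tensor A u from (tensorLeft A).map_smul c u,
          map_smul, hu0, smul_zero]
  have key (ε : ℝ) (hε : 0 < ε) : ‖T (tensor A B)‖ ≤ c * ((∑ i ∈ s, R i) * ε) := by
    obtain ⟨P, hP, hPf⟩ := exists_span_expFun_near hf hfc
      (hK₁.image_of_continuousOn ((continuousOn_extChartAt q).mono hK₁φ)) m hε
    obtain ⟨u, hu, hu0⟩ := hspan P hP
    have hTu : T (tensor A B) = T (tensor A (B - u)) := by
      rw [show tensor A (B - u) = tensor A B - tensor A u from (tensorLeft A).map_sub B u,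
        map_sub, hu0, sub_zero]
    rw [hTu]
    have hBu (x : Fin b → M) (hx : x ∈ φ.source) :
        ((B - u : PowTest D M b) : (Fin b → M) → ℂ) x = X x * (f (φ x) - P (φ x)) := by
      rw [mul_sub, ← hXB x hx, ← hu]
      rfl
    have hsupp : tsupport (tensor A (B - u) : (Fin (a + b) → M) → ℂ) ⊆ Q := by
      refine closure_minimal (fun x hx ↦ ?_) hQc
      refine ⟨subset_tsupport _ (left_ne_zero_of_mul hx), ?_⟩
      by_contra hx2
      have h2 : (B : (Fin b → M) → ℂ) (π₂ x) - (u : (Fin b → M) → ℂ) (π₂ x) ≠ 0 :=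
        right_ne_zero_of_mul hx
      refine h2 ?_
      rw [hu, hX0 _ hx2, zero_mul, sub_zero]
      refine image_eq_zero_of_notMem_tsupport fun h ↦ hx2 fun i _ ↦ ?_
      refine subset_tsupport _ ?_
      rw [Function.mem_support, hχ1 i _ (hB h i (Set.mem_univ i))]
      exact one_ne_zero
    refine hsT _ hsupp _ (mul_nonneg hR' hε.le) fun i hi y hy ↦ ?_
    refine (hR i hi (fun z ↦ f z - P z) (hf.sub (contDiff_of_mem_span_expFun hP)) ε hε.le
      (fun j hj x hx ↦ ?_) _ hsupp (fun x hx ↦ ?_) y hy).trans ?_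
    · exact hPf j (hj.trans (Finset.le_sup (f := fun i ↦ i.2.2) hi)) _
        (Set.mem_image_of_mem _ hx.2)
    · exact (congrArg _ (hBu _ hx)).trans (mul_assoc _ _ _).symm
    · exact mul_le_mul_of_nonneg_right (Finset.single_le_sum hR0 hi) hε.le
  have hlim : Filter.Tendsto (fun ε : ℝ ↦ c * ((∑ i ∈ s, R i) * ε)) (nhdsWithin 0 (Set.Ioi 0))
      (nhds 0) := by
    have : Continuous fun ε : ℝ ↦ c * ((∑ i ∈ s, R i) * ε) := by fun_prop
    simpa using (this.tendsto 0).mono_left nhdsWithin_le_nhds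
  refine norm_le_zero_iff.1 (ge_of_tendsto hlim ?_)
  filter_upwards [self_mem_nhdsWithin] with ε hε
  exact key ε hε

/-- Density of pure tensors: a distribution on `M^(a+b)` that annihilates `A ⊗ f_1 ⊗ ⋯ ⊗ f_b` for
all test functions `f_i` on `M` annihilates `A ⊗ B` for all `B ∈ C₀^∞(M^b)`. -/
theorem IsDistribution.tensor_eq_zero_of_pureTensor {a b : ℕ}
    {T : PowTest D M (a + b) →ₗ[ℂ] ℂ} (hT : IsDistribution T) (A : PowTest D M a)
    (h0 : ∀ f : Fin b → Test D M, T (tensor A (pureTensor f)) = 0) (B : PowTest D M b) :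
    T (tensor A B) = 0 := by
  have : LocallyCompactSpace M := ChartedSpace.locallyCompactSpace (Coord D) M
  let K : Set M := ⋃ i, (fun x : Fin b → M ↦ x i) '' tsupport (B : (Fin b → M) → ℂ)
  have hK : IsCompact K := isCompact_iUnion fun i ↦ B.2.2.isCompact.image (continuous_apply i)
  have hxK (x : Fin b → M) (hx : x ∈ tsupport (B : (Fin b → M) → ℂ)) (i : Fin b) : x i ∈ K :=
    Set.mem_iUnion.2 ⟨i, x, hx, rfl⟩
  obtain ⟨t, ht⟩ := hK.elim_finite_subcover (fun p : M ↦ (chartAt (Coord D) p).source)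
    (fun p ↦ (chartAt (Coord D) p).open_source)
    fun x _ ↦ Set.mem_iUnion.2 ⟨x, mem_chart_source _ x⟩
  obtain ⟨ρ, hρ⟩ := SmoothPartitionOfUnity.exists_isSubordinate 𝓘(ℝ, Coord D) hK.isClosed
    (fun p : t ↦ (chartAt (Coord D) (p : M)).source)
    (fun p ↦ (chartAt (Coord D) (p : M)).open_source)
    fun x hx ↦ by
      obtain ⟨p, hp, hxp⟩ := Set.mem_iUnion₂.1 (ht hx)
      exact Set.mem_iUnion.2 ⟨⟨p, hp⟩, hxp⟩
  -- products of a partition of unity on `M` cut `B` into pieces supported in products of charts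
  have hsm (j : Fin b → t) : ContMDiff (powModel D b) 𝓘(ℝ, ℂ) ∞
      fun x : Fin b → M ↦ ∏ i, (ρ (j i) (x i) : ℂ) :=
    contMDiff_prod_proj fun i ↦ Complex.ofRealCLM.contDiff.contMDiff.comp (ρ (j i)).contMDiff
  let Bj (j : Fin b → t) : PowTest D M b := B.smoothMul _ (hsm j)
  have hsum : B = ∑ j, Bj j := by
    refine Subtype.ext (funext fun x ↦ ?_)
    rw [AddSubmonoidClass.coe_finsetSum, Finset.sum_apply]
    change _ = ∑ j : Fin b → t, (∏ i, (ρ (j i) (x i) : ℂ)) * (B : (Fin b → M) → ℂ) x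
    rw [← Finset.sum_mul, ← Fintype.prod_sum (fun (i : Fin b) (p : t) ↦ (ρ p (x i) : ℂ))]
    by_cases hx : x ∈ tsupport (B : (Fin b → M) → ℂ)
    · rw [Finset.prod_eq_one fun i _ ↦ ?_, one_mul]
      have := ρ.sum_eq_one (hxK x hx i)
      rw [finsum_eq_sum_of_fintype] at this
      exact_mod_cast this
    · rw [image_eq_zero_of_notMem_tsupport hx, mul_zero]
  have hBj (j : Fin b → t) : T (tensor A (Bj j)) = 0 := by
    refine hT.tensor_eq_zero_of_tsupport_subset A h0 (fun i ↦ (j i : M))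
      (K := fun i ↦ K ∩ tsupport (ρ (j i))) (fun i ↦ hK.inter_right (isClosed_tsupport _))
      (fun i x hx ↦ hρ (j i) hx.2) (Bj j) ?_
    refine closure_minimal (fun x hx i _ ↦ ⟨hxK x ?_ i, ?_⟩)
      (isClosed_set_pi fun i _ ↦ hK.isClosed.inter (isClosed_tsupport _))
    · exact subset_tsupport _ (right_ne_zero_of_mul hx)
    · have h1 : (ρ (j i) (x i) : ℂ) ≠ 0 :=
        Finset.prod_ne_zero_iff.1 (left_ne_zero_of_mul hx) i (Finset.mem_univ i)
      exact subset_tsupport _ (by exact_mod_cast h1)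
  have : T (tensorLeft A B) = 0 := by
    rw [hsum, map_sum, map_sum]
    exact Finset.sum_eq_zero fun j _ ↦ hBj j
  exact this

end Density

/-! ### States and their commutation relations -/

section Algebra

variable {D : ℕ} {M : Type*} [TopologicalSpace M] [ChartedSpace (Coord D) M]

theorem tensor_mul_of {a b : ℕ} (f : PowTest D M a) (g : PowTest D M b) :
    DirectSum.of (PowTest D M) a f * DirectSum.of (PowTest D M) b g =
      DirectSum.of (PowTest D M) (a + b) (tensor f g) :=
  DirectSum.of_mul_of f g

/-- A pure tensor is a product of fields. -/
theorem of_pureTensor : ∀ {n : ℕ} (f : Fin n → Test D M),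
    DirectSum.of (PowTest D M) n (pureTensor f) = (List.ofFn fun i ↦ field (f i)).prod
  | 0, f => by
    rw [List.ofFn_zero, List.prod_nil]
    exact congrArg (DirectSum.of (PowTest D M) 0) (Subtype.ext (funext fun x ↦ by
      exact Finset.prod_empty (f := fun i ↦ (f i : M → ℂ) (x i))))
  | n + 1, f => by
    rw [List.ofFn_succ, List.prod_cons, ← of_pureTensor]
    refine Eq.trans ?_ (tensor_mul_of (oneVar (f 0)) _).symm
    refine DirectSum.of_eq_of_gradedMonoid_eq (gradedMk_eq (add_comm n 1) _ _ fun x ↦ ?_)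
    refine (Fin.prod_univ_succ _).trans (congrArg₂ _ ?_ (Finset.prod_congr rfl fun i _ ↦ ?_))
    · exact congrArg (f 0 : M → ℂ) (congrArg x (Fin.ext rfl))
    · exact congrArg (f i.succ : M → ℂ) (congrArg x (Fin.ext (by simp [add_comm])))

theorem field_mul_field (f h : Test D M) :
    field f * field h = DirectSum.lof ℂ ℕ (PowTest D M) 2 (tensor₂ f h) :=
  tensor_mul_of (oneVar f) (oneVar h)

/-- A functional vanishes on the two-sided `*`-ideal generated by `G` if it vanishes on `x a y` for
all `a ∈ G ∪ G*`. -/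
theorem eq_zero_of_mem_starIdeal (T : BUAlgebra D M →ₗ[ℂ] ℂ) {G : Set (BUAlgebra D M)}
    (hG : ∀ a ∈ G, ∀ x y, T (x * a * y) = 0 ∧ T (x * star a * y) = 0)
    {a : BUAlgebra D M} (ha : a ∈ starIdeal G) : T a = 0 := by
  let I : TwoSidedIdeal (BUAlgebra D M) := TwoSidedIdeal.mk' {a | ∀ x y, T (x * a * y) = 0}
    (fun x y ↦ by simp)
    (fun ha hb x y ↦ by rw [mul_add, add_mul, map_add, ha, hb, add_zero])
    (fun ha x y ↦ by rw [mul_neg, neg_mul, map_neg, ha, neg_zero])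
    (fun {b _} ha x y ↦ by rw [← mul_assoc]; exact ha (x * b) y)
    (fun {_ b} ha x y ↦ by rw [mul_assoc, mul_assoc, ← mul_assoc x]; exact ha x (b * y))
  have haI : a ∈ I := TwoSidedIdeal.mem_span_iff.1 ha I (by
    rintro b (hb | ⟨b, hb, rfl⟩)
    · exact (TwoSidedIdeal.mem_mk' ..).2 fun x y ↦ (hG b hb x y).1
    · exact (TwoSidedIdeal.mem_mk' ..).2 fun x y ↦ (hG b hb x y).2)
  simpa using (TwoSidedIdeal.mem_mk' ..).1 haI 1 1

namespace BUState

variable (w : BUState D M)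

theorem map_star (a : BUAlgebra D M) : w.toLin (star a) = starRingEnd ℂ (w.toLin a) := by
  -- the imaginary part of `ω((1+a)*(1+a))` and of `ω((1+ia)*(1+ia))` vanishes
  have h0 := (w.positive a).2
  have h1 := (w.positive (1 + a)).2
  have h2 := (w.positive (1 + Complex.I • a)).2
  simp only [star_add, star_one, star_smul, add_mul, mul_add, one_mul, mul_one, map_add,
    w.normalised, smul_mul_assoc, mul_smul_comm, map_smul, smul_eq_mul, RCLike.star_def,
    Complex.conj_I, Complex.add_im, Complex.mul_im, Complex.neg_im, Complex.neg_re, Complex.I_re,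
    Complex.I_im, Complex.one_im, Complex.mul_re] at h1 h2
  refine Complex.ext ?_ ?_
  · rw [Complex.conj_re]; linarith
  · rw [Complex.conj_im]; linarith

/-- The Cauchy-Schwarz inequality, in the degenerate case. -/
theorem mul_eq_zero_of_star_mul_self {a : BUAlgebra D M} (ha : w.toLin (star a * a) = 0)
    (b : BUAlgebra D M) : w.toLin (b * a) = 0 := by
  have hstar : w.toLin (star a * star b) = starRingEnd ℂ (w.toLin (b * a)) := by
    rw [← w.map_star, star_mul]
  set z := w.toLin (b * a)
  -- `0 ≤ ω(bb*) - 2 t |ω(ba)|²` for all `t`, from positivity at `b* - t z̄ a`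
  have hpos (t : ℝ) : 0 ≤ (w.toLin (b * star b)).re - 2 * t * (z.re ^ 2 + z.im ^ 2) := by
    have h := (w.positive (star b - ((t : ℂ) * starRingEnd ℂ z) • a)).1
    simp only [star_sub, star_star, star_smul, sub_mul, mul_sub, smul_mul_assoc, mul_smul_comm,
      map_sub, map_smul, ha, hstar, smul_eq_mul, mul_zero, sub_zero, star_mul, RCLike.star_def,
      Complex.conj_conj, Complex.conj_ofReal] at h
    change 0 ≤ (w.toLin (b * star b) - (z * t) * starRingEnd ℂ z -
      (t * starRingEnd ℂ z) * z).re at h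
    simp only [Complex.sub_re, Complex.mul_re, Complex.mul_im, Complex.ofReal_re,
      Complex.ofReal_im, Complex.conj_re, Complex.conj_im] at h
    linarith
  by_contra hz
  have hn : 0 < z.re ^ 2 + z.im ^ 2 := by
    have := Complex.normSq_pos.2 hz
    rw [Complex.normSq_apply] at this
    nlinarith
  have := hpos (((w.toLin (b * star b)).re + 1) / (2 * (z.re ^ 2 + z.im ^ 2)))
  field_simp at this
  linarith

theorem npoint_two (f h : Test D M) : w.npoint 2 (tensor₂ f h) = w.toLin (field f * field h) := by
  rw [field_mul_field]
  rfl

theorem twoPointMinus_tensor₂ (f h : Test D M) : w.twoPointMinus (tensor₂ f h) =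
    1 / 2 * (w.toLin (field f * field h) - w.toLin (field h * field f)) := by
  rw [← npoint_two, ← npoint_two]
  have : reverse 2 (tensor₂ f h) = tensor₂ h f := by
    refine Subtype.ext (funext fun x ↦ (mul_comm _ _).trans (congrArg₂ _ ?_ ?_))
    · exact congrArg (h : M → ℂ) (congrArg x rfl)
    · exact congrArg (f : M → ℂ) (congrArg x rfl)
  simp only [twoPointMinus, LinearMap.smul_apply, LinearMap.sub_apply, LinearMap.comp_apply, this,
    smul_eq_mul]

variable {w}

theorem HasCommutator.mul_comm_fields {E : PowTest D M 2 →ₗ[ℂ] ℂ} (hE : w.HasCommutator E)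
    (f h : Test D M) (x y : BUAlgebra D M) :
    w.toLin (x * (field f * field h) * y) = w.toLin (x * (field h * field f) * y) +
      Complex.I * E (tensor₂ f h) * w.toLin (x * y) := by
  have := hE _ (TwoSidedIdeal.mul_mem_right _ _ y (TwoSidedIdeal.mul_mem_left _ x _
    (TwoSidedIdeal.subset_span (Or.inl ⟨f, h, rfl⟩))))
  simp only [mul_sub, sub_mul, mul_smul_comm, smul_mul_assoc, mul_one, map_sub, map_smul,
    smul_eq_mul] at this
  linear_combination this

theorem HasCommutator.I_mul_eq {E : PowTest D M 2 →ₗ[ℂ] ℂ} (hE : w.HasCommutator E)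
    (f h : Test D M) : Complex.I * E (tensor₂ f h) =
      w.toLin (field f * field h) - w.toLin (field h * field f) := by
  have := hE.mul_comm_fields f h 1 1
  simp only [one_mul, mul_one, w.normalised] at this
  linear_combination -this

/-- A commutator of a generalised free field state enters only through its values on tensor
products, which are those of twice the antisymmetric part of the two-point distribution. -/
theorem HasCommutator.of_twoPointMinus {E E' : PowTest D M 2 →ₗ[ℂ] ℂ} (hE' : w.HasCommutator E')
    (h : w.twoPointMinus = (Complex.I / 2) • E) : w.HasCommutator E := by
  have heq (f k : Test D M) : Complex.I * E' (tensor₂ f k) = Complex.I * E (tensor₂ f k) := by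
    have h1 := w.twoPointMinus_tensor₂ f k
    rw [h, LinearMap.smul_apply, smul_eq_mul] at h1
    linear_combination hE'.I_mul_eq f k - 2 * h1
  unfold HasCommutator at hE' ⊢
  simpa only [heq] using hE'

/-- If `Φ(k)` has vanishing two-point distribution with all fields, then its commutators with them
vanish, so that in `x Φ(k) Φ(h_1) ⋯ Φ(h_n)` it can be moved to the right, where it annihilates the
vacuum. -/
theorem HasCommutator.field_mul_prod_eq_zero {E : PowTest D M 2 →ₗ[ℂ] ℂ}
    (hE : w.HasCommutator E) {k : Test D M}
    (hk : ∀ h : Test D M, w.toLin (field k * field h) = 0 ∧ w.toLin (field h * field k) = 0)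
    (hvac : ∀ x, w.toLin (x * field k) = 0) (l : List (Test D M)) (x : BUAlgebra D M) :
    w.toLin (x * field k * (l.map field).prod) = 0 := by
  induction l generalizing x with
  | nil => simpa using hvac x
  | cons h l ih =>
    have hc := hE.mul_comm_fields k h x (l.map field).prod
    rw [hE.I_mul_eq, (hk h).1, (hk h).2, sub_zero, zero_mul, add_zero] at hc
    rw [List.map_cons, List.prod_cons, ← mul_assoc, mul_assoc x, hc, ← mul_assoc]
    exact ih _

/-- If `Φ(k)` has vanishing two-point distribution with all fields, it vanishes between arbitrary
elements of the algebra: for pure tensors on its right it does so by commutation, and these are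
dense. -/
theorem HasCommutator.mul_field_mul_eq_zero [T2Space M] [SecondCountableTopology M]
    [IsManifold 𝓘(ℝ, Coord D) ∞ M] {E : PowTest D M 2 →ₗ[ℂ] ℂ}
    (hE : w.HasCommutator E) {k : Test D M}
    (hk : ∀ h : Test D M, w.toLin (field k * field h) = 0 ∧ w.toLin (field h * field k) = 0)
    (x y : BUAlgebra D M) : w.toLin (x * field k * y) = 0 := by
  have hvac (x : BUAlgebra D M) : w.toLin (x * field k) = 0 := by
    refine w.mul_eq_zero_of_star_mul_self ?_ x
    have hstar : star (field k) =
        field ⟨fun x ↦ starRingEnd ℂ ((k : M → ℂ) x),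
          Complex.conjCLE.contDiff.contMDiff.comp k.2.1, k.2.2.comp_left (map_zero _)⟩ := by
      refine (DirectSum.map_of _ _ _).trans (congrArg (DirectSum.of (PowTest D M) 1) ?_)
      exact Subtype.ext (funext fun x ↦ rfl)
    rw [hstar]
    exact (hk _).2
  induction x using DirectSum.induction_on with
  | zero => simp
  | add x x' hx hx' => rw [add_mul, add_mul, map_add, hx, hx', add_zero]
  | of a A =>
    induction y using DirectSum.induction_on with
    | zero => simp
    | add y y' hy hy' => rw [mul_add, map_add, hy, hy', add_zero]
    | of b B =>
      have hAk : DirectSum.of (PowTest D M) a A * field k =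
          DirectSum.of (PowTest D M) (a + 1) (tensor A (oneVar k)) := tensor_mul_of A (oneVar k)
      have := (w.continuous' (a + 1 + b)).tensor_eq_zero_of_pureTensor (tensor A (oneVar k))
        (fun f ↦ ?_) B
      · rw [hAk, tensor_mul_of]
        exact this
      · change w.toLin (DirectSum.of (PowTest D M) (a + 1 + b) _) = 0
        rw [← tensor_mul_of, ← hAk, of_pureTensor]
        have := hE.field_mul_prod_eq_zero hk hvac (List.ofFn f) (DirectSum.of (PowTest D M) a A)
        rwa [List.map_ofFn] at this

end BUState

end Algebra

end CurvedQFT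

end

theorem mainTheorem6 {D : ℕ} (hD : 2 ≤ D) {M : Type*} [TopologicalSpace M] [T2Space M]
    [SecondCountableTopology M] [ConnectedSpace M] [MeasurableSpace M] [BorelSpace M]
    [ChartedSpace (CurvedQFT.Coord D) M] [IsManifold 𝓘(ℝ, CurvedQFT.Coord D) ∞ M]
    (S : CurvedQFT.Spacetime D M) (hS : S.IsGloballyHyperbolic)
    (w : CurvedQFT.BUState D M) (hw : w.IsGeneralisedFreeField)
    (m ξ : ℝ) (hKG : S.IsBisolution m ξ (w.npoint 2))
    (E : CurvedQFT.PowTest D M 2 →ₗ[ℂ] ℂ) (hE : S.IsCausalPropagator m ξ E)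
    (hw₂ : w.twoPointMinus = (Complex.I / 2) • E) :
    w.IsFreeField S m ξ := by
  obtain ⟨E', -, hE'⟩ := hw
  have hwE : w.HasCommutator E := hE'.of_twoPointMinus hw₂
  refine ⟨fun a ha ↦ CurvedQFT.eq_zero_of_mem_starIdeal w.toLin ?_ ha, E, hE, hwE⟩
  rintro _ ⟨f, k, hk, rfl⟩ x y
  have h := hwE.mul_field_mul_eq_zero (k := k) fun h ↦ by
    rw [← w.npoint_two, ← w.npoint_two]
    exact hKG f k hk h
  refine ⟨h x y, ?_⟩
  have hst : x * star (CurvedQFT.field k) * y =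
      star (star y * CurvedQFT.field k * star x) := by
    simp only [star_mul, star_star, mul_assoc]
  rw [hst, w.map_star, h, map_zero]
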